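/- **Setting.** The player set is $N=\{1,\dots,n\}$. A Bayesian game $\Gamma=(N,\mathcal T,A,u,\mu)$ has finite sets $\mathcal T_i$ of types and finite nonempty sets $A_i$ of actions, a common prior $\mu$ on $\mathcal T=\prod_i\mathcal T_i$ and utilities $u_i:\mathcal T\times A\to\mathbb R$, where $A=\prod_i A_i$. A *utility variant* $\Gamma(u')$ of $\Gamma=\Gamma(u)$ differs from it only in the utilities. A *mediator* $d$ maps the inputs received so far, and its coin flips, to an output for each player. In the game $\Gamma_d$ play proceeds in an unbounded sequence of stages: each player sends a (possibly empty) finite message to $d$; $d$ sends each player a (possibly empty) finite message; each player then chooses an action or none. A player acts at most once, and a player $i$ that never acts is assigned a default action $a_i^*\in A_i$; utilities are those of $\Gamma$. In the cheap-talk game $\Gamma_{\rm CT}$ there are instead private point-to-point channels between all players (no broadcast). For an extension $\Gamma'$ of $\Gamma$ (possibly $\Gamma$ itself), $\Gamma'+CT(K)$ adds private channels among the players of $K$. Strategies are randomized: what a player sends and plays is a (measurable) function of its type, its own sequence of independent fair coin flips and the messages it has received; in $\Gamma$ itself a strategy maps the type and the coin flips to an action. Write $u_i(t_S,\Gamma',\sigma)$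 for the expected utility of $i$ under the profile $\sigma$ in $\Gamma'$, conditional on the players in $S$ having types $t_S$; below, $t_S$ ranges over type tuples of positive probability. * $\sigma$ is *$t$-immune* in $\Gamma'$ if $u_i(t_i,\Gamma'+CT(T),\tau_T,\sigma_{-T})\ge u_i(t_i,\Gamma',\sigma)$ for all $T\subseteq N$ with $|T|\le t$, all $\tau$, all $i\notin T$ and all $t_i$. * $\sigma$ is a *$(k,t)$-robust equilibrium* of $\Gamma'$ if it is $t$-immune and, for all disjoint $K,T\subseteq N$ with $1\le|K|\le k$, $|T|\le t$ and all $t_{K\cup T}$, there is no $\tau$ such that for all $i\in K$ $$u_i(t_{K\cup T},\Gamma'+CT(K\cup T),\tau_{K\cup T},\sigma_{-(K\cup T)})>u_i(t_{Q},\Gamma'+CT(T),\tau_T,\sigma_{-T}).$$ It is a *strong* $(k,t)$-robust equilibrium if the same holds with "for some $i\in K$" in place of "for all $i\in K$". Here $Q$ may be read throughout as $\{i\}$ or throughout as $K\cup T$. * A profile $\rho$ in $\Gamma$ is an *$m$-punishment strategy* with respect to $\sigma$ in $\Gamma_d$ if $u_i(t_K,\Gamma_d,\sigma)>u_i(t_K,\Gamma+CT(K),\phi_K,\rho_{-K})$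 for all $K\subseteq N$ with $|K|\le m$, all $\phi$, all $t_K$ and all $i\in K$. * $(\Gamma_{\rm CT}(u'),\sigma_{\rm CT})$ is a *$(k,t)$-robust implementation* of $(\Gamma_d(u'),\sigma)$ if $\sigma_{\rm CT}$ is a $(k,t)$-robust equilibrium of $\Gamma_{\rm CT}(u')$ and, for every type profile, $\sigma_{\rm CT}$ in $\Gamma_{\rm CT}$ and $\sigma$ in $\Gamma_d$ induce the same distribution over action profiles. **Theorem.** Let $n,k,t$ be natural numbers with $2k+2t<n\le 3k+3t$. There are a game $\Gamma(u)$ with $n$ players, a mediator $d$, a strategy profile $\sigma$ in $\Gamma_d$ and a strategy profile $\rho$ in $\Gamma$ such that, for every choice of the default actions and for either reading of $Q$: 1. $\sigma$ is a strong $(k,t)$-robust equilibrium of $\Gamma_d(u)$; 2. $\rho$ is a $(k+t)$-punishment strategy with respect to $\sigma$; 3. there is no strategy profile $\sigma_{\rm CT}$ in $\Gamma_{\rm CT}$ such that, for all utility variants $\Gamma(u')$ of $\Gamma(u)$, if $\sigma$ is a $(k,t)$-robust equilibrium of $\Gamma_d(u')$, then $(\Gamma_{\rm CT}(u'),\sigma_{\rm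 CT})$ is a $(k,t)$-robust implementation of $(\Gamma_d(u'),\sigma)$. -/

import Mathlib

open MeasureTheory

noncomputable section

namespace CheapTalk

/-- Messages are finite bit strings; `[]` is the empty message ("no message at all"). -/
abbrev Msg : Type := List Bool

/-- An infinite sequence of coin flips. -/
abbrev Coins : Type := ℕ → Bool

/-- The law of an infinite sequence of independent unbiased coin flips. -/
def coinLaw : Measure Coins :=
  Measure.infinitePi fun _ : ℕ => (PMF.uniformOfFintype Bool).toMeasure

/-- A Bayesian game with player set `Fin n`, without its utility functions: finite sets of types
and (nonempty) finite sets of actions, and a common prior on type profiles. -/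
structure GameForm (n : ℕ) where
  Ty : Fin n → Type
  Act : Fin n → Type
  [finTy : ∀ i, Fintype (Ty i)]
  [finAct : ∀ i, Fintype (Act i)]
  [nonemptyAct : ∀ i, Nonempty (Act i)]
  prior : PMF (∀ i, Ty i)

attribute [instance] GameForm.finTy GameForm.finAct GameForm.nonemptyAct

variable {n : ℕ}

/-- What a player sends in the first phase of a stage: a message to the mediator and a message
addressed to each player. -/
structure Sent (n : ℕ) where
  toMed : Msg
  toPlayer : Fin n → Msg

/-- What a player receives in the second phase of a stage: a message from the mediator and a
message from each player (`[]` where there is no channel). -/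
structure View (n : ℕ) where
  fromMed : Msg
  fromPlayer : Fin n → Msg

/-- A randomized strategy of one player with type set `Θ` and action set `A`, in any extension of
the underlying game: what is sent in the first phase of a stage, and the action (or `none`) chosen
in the third phase, as functions of the type, the coin flips, and the messages received so far
(most recent stage first). Messages sent earlier are determined by these data. -/
structure Strategy (n : ℕ) (Θ A : Type) where
  send : Θ → Coins → List (View n) → Sent n
  act : Θ → Coins → List (View n) → Option A
  measurable_send : ∀ θ h s, MeasurableSet {c | send θ c h = s}
  measurable_act : ∀ θ h a, MeasurableSet {c | act θ c h = a}

/-- A mediator maps its coin flips and the inputs of all players up to the current stage (most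
recent stage first) to an output for each player. -/
structure Mediator (n : ℕ) where
  out : Coins → List (Fin n → Msg) → Fin n → Msg
  measurable_out : ∀ h m, MeasurableSet {c | out c h = m}

/-- The mediator that only sends empty messages. -/
def Mediator.silent : Mediator n where
  out _ _ _ := []
  measurable_out _ _ := MeasurableSet.const _

/-- A way of extending an underlying game by communication: a mediator together with
point-to-point channels, where `link i j` means that messages from `i` to `j` are delivered. -/
structure Extension (n : ℕ) where
  med : Mediator n
  link : Fin n → Fin n → Prop

namespace Extension

/-- No communication: the underlying game itself. -/
def underlying : Extension n := ⟨Mediator.silent, fun _ _ => False⟩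

/-- The game with mediator `d`. -/
def mediated (d : Mediator n) : Extension n := ⟨d, fun _ _ => False⟩

/-- The cheap-talk game: all point-to-point channels, no mediator. -/
def cheapTalk : Extension n := ⟨Mediator.silent, fun _ _ => True⟩

/-- `E.addCT K` is `E + CT(K)`: private channels between the players of `K` are added. -/
def addCT (E : Extension n) (K : Finset (Fin n)) : Extension n :=
  ⟨E.med, fun i j => E.link i j ∨ (i ∈ K ∧ j ∈ K)⟩

end Extension

/-- Coin flips of the mediator and of all players. -/
abbrev Flips (n : ℕ) : Type := Coins × (Fin n → Coins)

/-- All coin flips are independent and unbiased. -/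
def flipsLaw (n : ℕ) : Measure (Flips n) :=
  coinLaw.prod (Measure.pi fun _ : Fin n => coinLaw)

namespace GameForm

variable (Γ : GameForm n)

/-- A utility function `u`: `u θ a i` is the utility of player `i` for types `θ` and actions `a`.
The utility variants of a game with form `Γ` are given by all utility functions. -/
abbrev Utility : Type := (∀ i, Γ.Ty i) → (∀ i, Γ.Act i) → Fin n → ℝ

/-- Strategy profiles (in extensions of the underlying game). -/
abbrev Profile : Type := ∀ i, Strategy n (Γ.Ty i) (Γ.Act i)

/-- A randomized strategy in the underlying game: a function from types and coin flips to
actions. -/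
structure BaseStrategy (i : Fin n) where
  act : Γ.Ty i → Coins → Γ.Act i
  measurable_act : ∀ θ a, MeasurableSet {c | act θ c = a}

/-- Strategy profiles in the underlying game. -/
abbrev BaseProfile : Type := ∀ i, Γ.BaseStrategy i

variable {Γ}

/-- A strategy of the underlying game, played without communicating. -/
def BaseStrategy.lift {i : Fin n} (ρ : Γ.BaseStrategy i) :
    Strategy n (Γ.Ty i) (Γ.Act i) where
  send _ _ _ := ⟨[], fun _ => []⟩
  act θ c _ := some (ρ.act θ c)
  measurable_send _ _ _ := MeasurableSet.const _
  measurable_act θ _ a := by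
    cases a with
    | none => simp
    | some a => simpa using ρ.measurable_act θ a

def BaseProfile.lift (ρ : Γ.BaseProfile) : Γ.Profile := fun i => (ρ i).lift

open Classical in
/-- `mix S τ σ` is the profile `(τ_S, σ_{-S})`. -/
def mix (S : Finset (Fin n)) (τ σ : Γ.Profile) : Γ.Profile :=
  fun i => if i ∈ S then τ i else σ i

open Classical in
/-- The messages received by each player, and the inputs received by the mediator, in the first
`m` stages of an execution (most recent stage first). -/
def history (E : Extension n) (σ : Γ.Profile) (θ : ∀ i, Γ.Ty i) (ω : Flips n) :
    ℕ → (Fin n → List (View n)) × List (Fin n → Msg)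
  | 0 => (fun _ => [], [])
  | m + 1 =>
    let prev := history E σ θ ω m
    let sent : Fin n → Sent n := fun i => (σ i).send (θ i) (ω.2 i) (prev.1 i)
    let inputs : List (Fin n → Msg) := (fun i => (sent i).toMed) :: prev.2
    let output : Fin n → Msg := E.med.out ω.1 inputs
    (fun i =>
      ⟨output i, fun j => if E.link j i then (sent j).toPlayer i else []⟩ :: prev.1 i,
      inputs)

/-- The action (if any) that the strategy of player `i` selects in the third phase of stage `m`
(stages are numbered from `0`). -/
def actionAt (E : Extension n) (σ : Γ.Profile) (θ : ∀ i, Γ.Ty i) (ω : Flips n) (i : Fin n)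
    (m : ℕ) : Option (Γ.Act i) :=
  (σ i).act (θ i) (ω.2 i) ((history E σ θ ω (m + 1)).1 i)

open Classical in
/-- The action profile played in an execution: a player can act only once, so the first selected
action counts; a player that never acts is assigned the default action. -/
def outcome (E : Extension n) (dflt : ∀ i, Γ.Act i) (σ : Γ.Profile) (θ : ∀ i, Γ.Ty i)
    (ω : Flips n) : ∀ i, Γ.Act i := fun i =>
  if h : ∃ m, (actionAt E σ θ ω i m).isSome = true then
    (actionAt E σ θ ω i (Nat.find h)).get (Nat.find_spec h)
  else dflt i

/-- The probability that the action profile `a` is played when the types are `θ`. -/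
def outcomeProb (E : Extension n) (dflt : ∀ i, Γ.Act i) (σ : Γ.Profile) (θ : ∀ i, Γ.Ty i)
    (a : ∀ i, Γ.Act i) : ℝ :=
  (flipsLaw n).real {ω | outcome E dflt σ θ ω = a}

/-- Expected utility of player `i` when the types are `θ`. -/
def expUtil (E : Extension n) (dflt : ∀ i, Γ.Act i) (u : Γ.Utility) (θ : ∀ i, Γ.Ty i)
    (σ : Γ.Profile) (i : Fin n) : ℝ :=
  ∑ a, outcomeProb E dflt σ θ a * u θ a i

variable (Γ) in
open Classical in
/-- The prior probability that the players in `S` have the types `θ_S`. -/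
def typeProb (S : Finset (Fin n)) (θ : ∀ i, Γ.Ty i) : ℝ :=
  ∑ θ', if ∀ j ∈ S, θ' j = θ j then (Γ.prior θ').toReal else 0

open Classical in
/-- `u_i(θ_S, σ)`: expected utility of player `i` conditional on the players in `S` having the
types `θ_S` (meaningful if `θ_S` has positive probability). -/
def condUtil (E : Extension n) (dflt : ∀ i, Γ.Act i) (u : Γ.Utility) (S : Finset (Fin n))
    (θ : ∀ i, Γ.Ty i) (σ : Γ.Profile) (i : Fin n) : ℝ :=
  (∑ θ', if ∀ j ∈ S, θ' j = θ j then (Γ.prior θ').toReal * expUtil E dflt u θ' σ i else 0)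
    / Γ.typeProb S θ

/-- `σ₁` (in the extension `E₁`) implements `σ₂` (in `E₂`). -/
def Implements (dflt : ∀ i, Γ.Act i) (E₁ : Extension n) (σ₁ : Γ.Profile)
    (E₂ : Extension n) (σ₂ : Γ.Profile) : Prop :=
  ∀ θ a, outcomeProb E₁ dflt σ₁ θ a = outcomeProb E₂ dflt σ₂ θ a

/-- `t`-immunity. -/
def IsImmune (E : Extension n) (dflt : ∀ i, Γ.Act i) (u : Γ.Utility) (t : ℕ)
    (σ : Γ.Profile) : Prop :=
  ∀ T : Finset (Fin n), T.card ≤ t → ∀ τ : Γ.Profile, ∀ i ∉ T, ∀ θ : ∀ j, Γ.Ty j,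
    0 < Γ.typeProb {i} θ →
      condUtil E dflt u {i} θ σ i ≤ condUtil (E.addCT T) dflt u {i} θ (mix T τ σ) i

end GameForm

/-- The types on which the payoff of `i ∈ K` with which a joint deviation of `K ∪ T` is compared
is conditioned: the type of player `i` only, or the types of all players in `K ∪ T`. -/
inductive Baseline where
  | own
  | coalition

/-- The set of players whose types the comparison payoff of `i` is conditioned on, if `S` is the
deviating coalition. -/
def Baseline.players (b : Baseline) (S : Finset (Fin n)) (i : Fin n) : Finset (Fin n) :=
  match b with
  | .own => {i}
  | .coalition => S

namespace GameForm

variable {Γ : GameForm n}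

/-- With the strategies `τ`, player `i` does strictly better if `K` joins the deviation of `T`
than if only `T` deviates. -/
def Gains (b : Baseline) (E : Extension n) (dflt : ∀ i, Γ.Act i) (u : Γ.Utility)
    (σ τ : Γ.Profile) (K T : Finset (Fin n)) (θ : ∀ j, Γ.Ty j) (i : Fin n) : Prop :=
  condUtil (E.addCT T) dflt u (b.players (K ∪ T) i) θ (mix T τ σ) i <
    condUtil (E.addCT (K ∪ T)) dflt u (K ∪ T) θ (mix (K ∪ T) τ σ) i

/-- `(k,t)`-robust equilibrium: `t`-immune, and no deviation is profitable for all players of a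
(nonempty) coalition `K`. -/
def IsRobust (b : Baseline) (E : Extension n) (dflt : ∀ i, Γ.Act i) (u : Γ.Utility)
    (k t : ℕ) (σ : Γ.Profile) : Prop :=
  IsImmune E dflt u t σ ∧
    ∀ K T : Finset (Fin n), K.Nonempty → K.card ≤ k → T.card ≤ t → Disjoint K T →
      ∀ θ : ∀ j, Γ.Ty j, 0 < Γ.typeProb (K ∪ T) θ →
        ¬ ∃ τ : Γ.Profile, ∀ i ∈ K, Gains b E dflt u σ τ K T θ i

/-- Strong `(k,t)`-robust equilibrium: `t`-immune, and no deviation is profitable for some player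
of a coalition `K`. -/
def IsStronglyRobust (b : Baseline) (E : Extension n) (dflt : ∀ i, Γ.Act i) (u : Γ.Utility)
    (k t : ℕ) (σ : Γ.Profile) : Prop :=
  IsImmune E dflt u t σ ∧
    ∀ K T : Finset (Fin n), K.card ≤ k → T.card ≤ t → Disjoint K T →
      ∀ θ : ∀ j, Γ.Ty j, 0 < Γ.typeProb (K ∪ T) θ →
        ¬ ∃ τ : Γ.Profile, ∃ i ∈ K, Gains b E dflt u σ τ K T θ i

/-- `ρ`, in the underlying game, is an `m`-punishment strategy with respect to `σ` in the game
with mediator `d`. -/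
def IsPunishment (d : Mediator n) (dflt : ∀ i, Γ.Act i) (u : Γ.Utility) (m : ℕ)
    (σ : Γ.Profile) (ρ : Γ.BaseProfile) : Prop :=
  ∀ K : Finset (Fin n), K.card ≤ m → ∀ φ : Γ.Profile,
    ∀ θ : ∀ j, Γ.Ty j, 0 < Γ.typeProb K θ → ∀ i ∈ K,
      condUtil (Extension.underlying.addCT K) dflt u K θ (mix K φ ρ.lift) i <
        condUtil (Extension.mediated d) dflt u K θ σ i

/-- The cheap-talk strategy `σct` is a `(k,t)`-robust implementation of `σ`, a strategy profile
in the game with mediator `d`. -/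
def IsRobustImplementation (b : Baseline) (d : Mediator n) (dflt : ∀ i, Γ.Act i)
    (u : Γ.Utility) (k t : ℕ) (σ σct : Γ.Profile) : Prop :=
  Implements dflt Extension.cheapTalk σct (Extension.mediated d) σ ∧
    IsRobust b Extension.cheapTalk dflt u k t σct

end GameForm

end CheapTalk

end

noncomputable section

namespace CheapTalk

variable {n : ℕ}

/-! Put `f = k + t`. The witness is an agreement game: types are uniform bits, the mediator
broadcasts the majority of the reported bits, and everybody plays the bit received. Since `2 * f <
n`, no `f` deviators can spoil agreement among the others or override a unanimous type
(`exists_outcome_obedient`). Hence obedience is strongly robust for every utility that vanishes on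
`Acceptable` outcomes. The extra action `none` supplies the punishment: utility is `-1` when all but
at most `f` players choose it.

Suppose one cheap-talk profile implemented obedience robustly for all variants. Apply this to the
variants that pay `-1` and `1` on unacceptable outcomes. Immunity in the first shows that `t`
players alone cannot cause such an outcome; robustness in the second then shows that `k + t` players
cannot (`eventProb_eq_zero_of_isRobust`). The profile would thus solve Byzantine agreement almost
surely against `f` faults with `n ≤ 3 * f`.

This is refuted by a covering argument (`not_forall_ae_acceptable`). Split the players into blocks
A, B, C of size at most `f`, and run the protocol on the double cover in which links between A and C
change level and types equal levels. For each block there is a choice of one copy of every other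
player such that these copies cannot tell the cover from a genuine run in which that block is faulty
and simulates the remaining copies (`history_simProfile`, `ae_coverOutcome`). The three resulting
conditions hold together for some coin flips of the cover and contradict each other. -/

instance : IsProbabilityMeasure coinLaw := by
  unfold coinLaw; infer_instance

instance : IsProbabilityMeasure (flipsLaw n) := by
  unfold flipsLaw; infer_instance

/-! ### Countability and coding of transmissions -/

theorem Sent.toPair_injective :
    Function.Injective (fun s : Sent n => (s.toMed, s.toPlayer)) := by
  rintro ⟨a, b⟩ ⟨c, d⟩ h
  simpa using h

theorem View.toPair_injective :
    Function.Injective (fun v : View n => (v.fromMed, v.fromPlayer)) := by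
  rintro ⟨a, b⟩ ⟨c, d⟩ h
  simpa using h

instance : Countable (Sent n) := Sent.toPair_injective.countable

instance : Countable (View n) := View.toPair_injective.countable

instance : Nonempty (Sent n) := ⟨⟨[], fun _ => []⟩⟩

/-- Any two transmissions can be encoded in one message. -/
theorem exists_injective_code : ∃ f : (Bool → Sent n) → Msg, Function.Injective f := by
  obtain ⟨g, hg⟩ := exists_injective_nat (Bool → Sent n)
  refine ⟨fun x => List.replicate (g x) true, fun x y h => hg ?_⟩
  simpa using congrArg List.length h

def code : (Bool → Sent n) → Msg := exists_injective_code.choose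

def decode : Msg → Bool → Sent n := Function.invFun code

theorem decode_code (x : Bool → Sent n) : decode (code x) = x :=
  Function.leftInverse_invFun exists_injective_code.choose_spec x

/-! ### The first selected action -/

open Classical in
/-- The first selected action, or the default `d` if there is none. -/
def firstAction {A : Type} (d : A) (x : ℕ → Option A) : A :=
  if h : ∃ m, (x m).isSome = true then (x (Nat.find h)).get (Nat.find_spec h) else d

theorem firstAction_of_eq_some {A : Type} {d a : A} {x : ℕ → Option A} {m : ℕ}
    (hm : x m = some a) (hlt : ∀ j < m, x j = none) : firstAction d x = a := by
  classical
  have h : ∃ m, (x m).isSome = true := ⟨m, by simp [hm]⟩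
  have hf : Nat.find h = m := by
    rw [Nat.find_eq_iff]
    exact ⟨by simp [hm], fun j hj => by simp [hlt j hj]⟩
  have : x (Nat.find h) = some a := by rw [hf, hm]
  rw [firstAction, dif_pos h]
  exact Option.get_of_mem _ this

theorem firstAction_eq_iff {A : Type} {d a : A} {x : ℕ → Option A} :
    firstAction d x = a ↔
      (∃ m, x m = some a ∧ ∀ j < m, x j = none) ∨ (d = a ∧ ∀ m, x m = none) := by
  classical
  constructor
  · intro h
    by_cases hex : ∃ m, (x m).isSome = true
    · left
      obtain ⟨b, hb⟩ := Option.isSome_iff_exists.1 (Nat.find_spec hex)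
      have hlt : ∀ j < Nat.find hex, x j = none := fun j hj => by
        simpa using Nat.find_min hex hj
      have := firstAction_of_eq_some (d := d) hb hlt
      exact ⟨_, by rw [hb, ← this, h], hlt⟩
    · right
      rw [firstAction, dif_neg hex] at h
      exact ⟨h, fun m => by simpa using fun hm => hex ⟨m, hm⟩⟩
  · rintro (⟨m, hm, hlt⟩ | ⟨h, hnone⟩)
    · exact firstAction_of_eq_some hm hlt
    · rw [firstAction, dif_neg (by simp [hnone]), h]

theorem measurableSet_firstAction_eq {Z A : Type} [MeasurableSpace Z] {d a : A}
    {x : Z → ℕ → Option A} (hx : ∀ m o, MeasurableSet {z | x z m = o}) :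
    MeasurableSet {z | firstAction d (x z) = a} := by
  have key : {z | firstAction d (x z) = a} =
      (⋃ m, {z | x z m = some a} ∩ ⋂ (j : ℕ) (_ : j < m), {z | x z j = none}) ∪
        ({_z | d = a} ∩ ⋂ m, {z | x z m = none}) := by
    ext z
    simp [firstAction_eq_iff]
  rw [key]
  exact (MeasurableSet.iUnion fun m => (hx m _).inter
    (.iInter fun j => .iInter fun _ => hx j none)).union
    ((MeasurableSet.const _).inter (.iInter fun m => hx m none))

namespace GameForm

variable {Γ : GameForm n}

theorem outcome_eq_firstAction (E : Extension n) (dflt : ∀ i, Γ.Act i) (σ : Γ.Profile)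
    (θ : ∀ i, Γ.Ty i) (ω : Flips n) (i : Fin n) :
    outcome E dflt σ θ ω i = firstAction (dflt i) (actionAt E σ θ ω i) := rfl

theorem mix_of_mem {S : Finset (Fin n)} {τ σ : Γ.Profile} {i : Fin n} (h : i ∈ S) :
    mix S τ σ i = τ i := by simp [mix, h]

theorem mix_of_notMem {S : Finset (Fin n)} {τ σ : Γ.Profile} {i : Fin n} (h : i ∉ S) :
    mix S τ σ i = σ i := by simp [mix, h]

/-! ### The double cover of the network

Every player `i` has two copies `(i, false)` and `(i, true)`; a copy of `j` listens to the copy of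
`i` on the same level, unless `cross j i`. -/

/-- The messages received by each copy in the double cover, where copy `(i, b)` has type `ϑ i b`
and coin flips `z (i, b)`. -/
def coverHistory (σ : Γ.Profile) (ϑ : ∀ i, Bool → Γ.Ty i) (cross : Fin n → Fin n → Bool)
    (z : Fin n × Bool → Coins) : ℕ → Fin n × Bool → List (View n)
  | 0 => fun _ => []
  | m + 1 =>
    let prev := coverHistory σ ϑ cross z m
    fun y => ⟨[], fun i => ((σ i).send (ϑ i (y.2 ^^ cross y.1 i)) (z (i, y.2 ^^ cross y.1 i))
      (prev (i, y.2 ^^ cross y.1 i))).toPlayer y.1⟩ :: prev y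

def coverOutcome (dflt : ∀ i, Γ.Act i) (σ : Γ.Profile) (ϑ : ∀ i, Bool → Γ.Ty i)
    (cross : Fin n → Fin n → Bool) (z : Fin n × Bool → Coins) (y : Fin n × Bool) : Γ.Act y.1 :=
  firstAction (dflt y.1) fun m =>
    (σ y.1).act (ϑ y.1 y.2) (z y) (coverHistory σ ϑ cross z (m + 1) y)

/-- Histories and transmissions range over countable sets, so a stage can be split according to the
previous history and what every copy sends. -/
theorem measurableSet_coverHistory_eq (σ : Γ.Profile) (ϑ : ∀ i, Bool → Γ.Ty i)
    (cross : Fin n → Fin n → Bool) (m : ℕ) (H : Fin n × Bool → List (View n)) :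
    MeasurableSet {z | coverHistory σ ϑ cross z m = H} := by
  induction m generalizing H with
  | zero => exact MeasurableSet.const ((fun _ => []) = H)
  | succ m ih =>
    have key : {z | coverHistory σ ϑ cross z (m + 1) = H} =
        ⋃ (G : Fin n × Bool → List (View n)) (s : Fin n × Bool → Sent n)
          (_ : (fun y => (⟨[], fun i => (s (i, y.2 ^^ cross y.1 i)).toPlayer y.1⟩ : View n) :: G y)
            = H), {z | coverHistory σ ϑ cross z m = G} ∩
              ⋂ y : Fin n × Bool, {z | (σ y.1).send (ϑ y.1 y.2) (z y) (G y) = s y} := by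
      ext z
      simp only [Set.mem_ofPred_eq, Set.mem_iUnion, Set.mem_inter_iff, Set.mem_iInter]
      constructor
      · intro h
        exact ⟨_, fun y => (σ y.1).send (ϑ y.1 y.2) (z y) (coverHistory σ ϑ cross z m y), h,
          rfl, fun y => rfl⟩
      · rintro ⟨G, s, h, rfl, hs⟩
        rw [← h]
        funext y
        simp only [coverHistory, ← hs]
    rw [key]
    refine .iUnion fun G => .iUnion fun s => .iUnion fun _ => (ih G).inter (.iInter fun y => ?_)
    exact ((σ y.1).measurable_send (ϑ y.1 y.2) (G y) (s y)).preimage (measurable_pi_apply y)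

theorem measurableSet_coverOutcome_eq (dflt : ∀ i, Γ.Act i) (σ : Γ.Profile)
    (ϑ : ∀ i, Bool → Γ.Ty i) (cross : Fin n → Fin n → Bool) (y : Fin n × Bool) (a : Γ.Act y.1) :
    MeasurableSet {z | coverOutcome dflt σ ϑ cross z y = a} := by
  refine measurableSet_firstAction_eq fun m o => ?_
  have key : {z | (σ y.1).act (ϑ y.1 y.2) (z y) (coverHistory σ ϑ cross z (m + 1) y) = o} =
      ⋃ G : Fin n × Bool → List (View n), {z | coverHistory σ ϑ cross z (m + 1) = G} ∩
        {z | (σ y.1).act (ϑ y.1 y.2) (z y) (G y) = o} := by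
    ext z; simp
  rw [key]
  exact .iUnion fun G => (measurableSet_coverHistory_eq σ ϑ cross _ G).inter
    (((σ y.1).measurable_act (ϑ y.1 y.2) (G y) o).preimage (measurable_pi_apply y))

/-! ### Simulating the double cover

The players outside `S` run the copies `(i, s i)`; the coalition `S` simulates all other copies,
with hardwired coin flips `x`. -/

open Classical in
/-- What copy `y` sent in a stage, according to a member of the coalition with view `v`. -/
def simSent (S : Finset (Fin n)) (s : Fin n → Bool) (σ : Γ.Profile) (ϑ : ∀ i, Bool → Γ.Ty i)
    (x : Fin n × Bool → Coins) (v : View n) (H : Fin n × Bool → List (View n))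
    (y : Fin n × Bool) : Sent n :=
  if y.1 ∈ S then decode (v.fromPlayer y.1) y.2
  else if y.2 = s y.1 then ⟨[], fun _ => v.fromPlayer y.1⟩
  else (σ y.1).send (ϑ y.1 y.2) (x y) (H y)

/-- The views of the copies in the double cover, as computed by a member of the coalition. -/
def simHistory (S : Finset (Fin n)) (s : Fin n → Bool) (cross : Fin n → Fin n → Bool)
    (σ : Γ.Profile) (ϑ : ∀ i, Bool → Γ.Ty i) (x : Fin n × Bool → Coins) :
    List (View n) → Fin n × Bool → List (View n)
  | [] => fun _ => []
  | v :: h => fun y =>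
    ⟨[], fun i => (simSent S s σ ϑ x v (simHistory S s cross σ ϑ x h)
      (i, y.2 ^^ cross y.1 i)).toPlayer y.1⟩ :: simHistory S s cross σ ϑ x h y

open Classical in
/-- The strategies of the simulating coalition, which plays the actions `a`. -/
def simProfile (S : Finset (Fin n)) (s : Fin n → Bool) (cross : Fin n → Fin n → Bool)
    (σ : Γ.Profile) (ϑ : ∀ i, Bool → Γ.Ty i) (x : Fin n × Bool → Coins) (a : ∀ i, Γ.Act i) :
    Γ.Profile := fun j =>
  { send := fun _ _ h =>
      let out : Bool → Sent n := fun b =>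
        (σ j).send (ϑ j b) (x (j, b)) (simHistory S s cross σ ϑ x h (j, b))
      ⟨[], fun i => if i ∈ S then code out else (out (s i ^^ cross i j)).toPlayer i⟩
    act := fun _ _ _ => some (a j)
    measurable_send := fun _ _ _ => MeasurableSet.const _
    measurable_act := fun _ _ _ => MeasurableSet.const _ }

open Classical in
/-- The coin flips of all copies, if the copies outside the coalition have coin flips `c`. -/
def splice (S : Finset (Fin n)) (s : Fin n → Bool) (x : Fin n × Bool → Coins)
    (c : Fin n → Coins) : Fin n × Bool → Coins :=
  fun y => if y.1 ∉ S ∧ y.2 = s y.1 then c y.1 else x y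

section Simulation

variable {S : Finset (Fin n)} {s : Fin n → Bool} {cross : Fin n → Fin n → Bool}
  {σ : Γ.Profile} {ϑ : ∀ i, Bool → Γ.Ty i} {x : Fin n × Bool → Coins} {a : ∀ i, Γ.Act i}
  {E : Extension n} {θ : ∀ i, Γ.Ty i}

/-- By `hs`, the real copies of outsiders hear only real copies of other outsiders, and the opposite
copies only opposite ones. The opposite copies can therefore be simulated by each member from the
hardwired coins and what the coalition's copies send. A member sees only the outsiders' messages to
itself, so its computation is claimed correct just for its own two copies and the outsiders'
opposite copies. -/
theorem history_simProfile (hs : ∀ i ∉ S, ∀ j ∉ S, (s i ^^ cross i j) = s j)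
    (hmed : E.med = Mediator.silent) (hlink : ∀ i j, E.link i j) (hθ : ∀ i ∉ S, θ i = ϑ i (s i))
    (ω : Flips n) (m : ℕ) :
    (∀ i ∉ S, (history E (mix S (simProfile S s cross σ ϑ x a) σ) θ ω m).1 i =
      coverHistory σ ϑ cross (splice S s x ω.2) m (i, s i)) ∧
    ∀ j ∈ S, ∀ y : Fin n × Bool, (y.1 = j ∨ y.1 ∉ S ∧ y.2 = !s y.1) →
      simHistory S s cross σ ϑ x
        ((history E (mix S (simProfile S s cross σ ϑ x a) σ) θ ω m).1 j) y =
      coverHistory σ ϑ cross (splice S s x ω.2) m y := by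
  induction m with
  | zero => exact ⟨fun i hi => rfl, fun j hj y hy => rfl⟩
  | succ m ih =>
    obtain ⟨ih₁, ih₂⟩ := ih
    set ρ := mix S (simProfile S s cross σ ϑ x a) σ with hρ
    set z := splice S s x ω.2 with hz
    set hist := history E ρ θ ω m with hhist
    set sent : Fin n → Sent n := fun i => (ρ i).send (θ i) (ω.2 i) (hist.1 i) with hsent
    set cs : Fin n × Bool → Sent n := fun y =>
      (σ y.1).send (ϑ y.1 y.2) (z y) (coverHistory σ ϑ cross z m y) with hcs
    have hout : ∀ i ∉ S, sent i = cs (i, s i) := by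
      intro i hi
      have : z (i, s i) = ω.2 i := by simp [hz, splice, hi]
      simp only [hsent, hcs, hρ, mix_of_notMem hi, hθ i hi, this, ih₁ i hi]
    have hin : ∀ j ∈ S, ∀ i, (sent j).toPlayer i =
        if i ∈ S then code (fun b => cs (j, b)) else (cs (j, s i ^^ cross i j)).toPlayer i := by
      intro j hj i
      have hzx : ∀ b, z (j, b) = x (j, b) := by simp [hz, splice, hj]
      simp only [hsent, hcs, hρ, mix_of_mem hj, simProfile, hzx]
      simp only [ih₂ j hj (j, _) (Or.inl rfl)]
    have hview : ∀ i, (history E ρ θ ω (m + 1)).1 i =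
        ⟨[], fun j => (sent j).toPlayer i⟩ :: hist.1 i := by
      intro i
      simp only [history, hmed, hlink, if_true]
      rfl
    have hcover : ∀ y, coverHistory σ ϑ cross z (m + 1) y =
        ⟨[], fun i => (cs (i, y.2 ^^ cross y.1 i)).toPlayer y.1⟩ ::
          coverHistory σ ϑ cross z m y := fun y => rfl
    refine ⟨fun i hi => ?_, fun j hj y hy => ?_⟩
    · rw [hview, hcover, ih₁ i hi]
      congr 2
      funext p
      by_cases hp : p ∈ S
      · rw [hin p hp, if_neg hi]
      · rw [hout p hp]
        simp only [hs i hi p hp]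
    · rw [hview, hcover, ← ih₂ j hj y hy]
      simp only [simHistory]
      congr 2
      funext p
      by_cases hp : p ∈ S
      · simp only [simSent, hp, if_true, hin p hp, hj, decode_code]
      · by_cases hc : (y.2 ^^ cross y.1 p) = s p
        · simp only [simSent, hp, if_false, hc, if_true, hout p hp]
          rcases hy with rfl | ⟨hy, hy'⟩
          · rfl
          · have := hs _ hy p hp
            rw [hy', ← this] at hc
            cases s y.1 <;> cases cross y.1 p <;> simp at hc
        · have hc' : (y.2 ^^ cross y.1 p) = !s p := by
            revert hc; cases (y.2 ^^ cross y.1 p) <;> cases s p <;> simp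
          have hzx : z (p, !s p) = x (p, !s p) := by simp [hz, splice]
          simp only [simSent, hp, if_false, hc', hcs]
          simp [hzx, ih₂ j hj (p, !s p) (Or.inr ⟨hp, rfl⟩)]

theorem outcome_simProfile_of_notMem (hs : ∀ i ∉ S, ∀ j ∉ S, (s i ^^ cross i j) = s j)
    (hmed : E.med = Mediator.silent) (hlink : ∀ i j, E.link i j) (hθ : ∀ i ∉ S, θ i = ϑ i (s i))
    (dflt : ∀ i, Γ.Act i) (ω : Flips n) {i : Fin n} (hi : i ∉ S) :
    outcome E dflt (mix S (simProfile S s cross σ ϑ x a) σ) θ ω i =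
      coverOutcome dflt σ ϑ cross (splice S s x ω.2) (i, s i) := by
  rw [outcome_eq_firstAction, coverOutcome]
  congr 1
  funext m
  have : splice S s x ω.2 (i, s i) = ω.2 i := by simp [splice, hi]
  rw [actionAt, (history_simProfile hs hmed hlink hθ ω (m + 1)).1 i hi, mix_of_notMem hi, this,
    hθ i hi]

theorem outcome_simProfile_of_mem (dflt : ∀ i, Γ.Act i) (ω : Flips n) {i : Fin n} (hi : i ∈ S) :
    outcome E dflt (mix S (simProfile S s cross σ ϑ x a) σ) θ ω i = a i := by
  rw [outcome_eq_firstAction]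
  refine firstAction_of_eq_some (m := 0) ?_ (by simp)
  rw [actionAt, mix_of_mem hi]
  rfl

end Simulation

/-! ### From hardwired coins to random coins -/

/-- Each coordinate of the spliced family is read from exactly one of the two independent sources,
and no source coordinate is used twice. So the preimage of a box is a product of boxes, whose unused
sides have mass one. -/
theorem measurePreserving_splice (S : Finset (Fin n)) (s : Fin n → Bool) :
    MeasurePreserving (fun p : (Fin n × Bool → Coins) × (Fin n → Coins) => splice S s p.1 p.2)
      ((Measure.pi fun _ => coinLaw).prod (Measure.pi fun _ => coinLaw))
      (Measure.pi fun _ => coinLaw) := by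
  classical
  have hmeas : Measurable
      (fun p : (Fin n × Bool → Coins) × (Fin n → Coins) => splice S s p.1 p.2) := by
    refine measurable_pi_lambda _ fun y => ?_
    by_cases h : y.1 ∉ S ∧ y.2 = s y.1
    · simp only [splice, if_pos h]; fun_prop
    · simp only [splice, if_neg h]; fun_prop
  refine ⟨hmeas, (Measure.pi_eq fun t ht => ?_).symm⟩
  rw [Measure.map_apply hmeas (MeasurableSet.univ_pi ht)]
  have key : (fun p : (Fin n × Bool → Coins) × (Fin n → Coins) => splice S s p.1 p.2) ⁻¹'
      Set.univ.pi t =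
      (Set.univ.pi fun y => if y.1 ∉ S ∧ y.2 = s y.1 then Set.univ else t y) ×ˢ
      (Set.univ.pi fun i => if i ∉ S then t (i, s i) else Set.univ) := by
    ext p
    simp only [Set.mem_preimage, Set.mem_pi, Set.mem_univ, true_implies, Set.mem_prod, splice]
    constructor
    · intro h
      refine ⟨fun y => ?_, fun i => ?_⟩
      · have := h y
        split_ifs at this ⊢ <;> simp_all
      · have := h (i, s i)
        by_cases hi : i ∈ S <;> simp_all
    · rintro ⟨h₁, h₂⟩ y
      by_cases h : y.1 ∉ S ∧ y.2 = s y.1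
      · have := h₂ y.1
        rw [if_pos h]
        rw [if_pos h.1, ← h.2] at this
        exact this
      · have := h₁ y
        rw [if_neg h] at this ⊢
        exact this
  rw [key, Measure.prod_prod, Measure.pi_pi, Measure.pi_pi, Fintype.prod_prod_type,
    Fintype.prod_prod_type, ← Finset.prod_mul_distrib]
  refine Finset.prod_congr rfl fun i _ => ?_
  by_cases hi : i ∈ S
  · simp [hi]
  · cases h : s i <;> simp [hi, h, mul_comm]

/-- If, whatever the hardwired coin flips, the outcome of the simulation is almost surely in `G`,
then so is the outcome of the double cover. -/
theorem ae_coverOutcome {S : Finset (Fin n)} {s : Fin n → Bool} {cross : Fin n → Fin n → Bool}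
    {σ : Γ.Profile} {ϑ : ∀ i, Bool → Γ.Ty i} {a : ∀ i, Γ.Act i}
    {E : Extension n} {θ : ∀ i, Γ.Ty i} (dflt : ∀ i, Γ.Act i)
    (hs : ∀ i ∉ S, ∀ j ∉ S, (s i ^^ cross i j) = s j)
    (hmed : E.med = Mediator.silent) (hlink : ∀ i j, E.link i j) (hθ : ∀ i ∉ S, θ i = ϑ i (s i))
    (G : Set (∀ i, Γ.Act i))
    (h : ∀ τ : Γ.Profile, ∀ᵐ ω ∂flipsLaw n, outcome E dflt (mix S τ σ) θ ω ∈ G) :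
    ∀ᵐ z ∂(Measure.pi fun _ : Fin n × Bool => coinLaw), ∃ o ∈ G, (∀ i ∈ S, o i = a i) ∧
      ∀ i ∉ S, o i = coverOutcome dflt σ ϑ cross z (i, s i) := by
  classical
  set good : Set (Fin n × Bool → Coins) := {z | ∃ o ∈ G, (∀ i ∈ S, o i = a i) ∧
      ∀ i ∉ S, o i = coverOutcome dflt σ ϑ cross z (i, s i)} with hgood
  have hmeas : MeasurableSet good := by
    have : good = ⋃ (o : ∀ i, Γ.Act i) (_ : o ∈ G ∧ ∀ i ∈ S, o i = a i),
        ⋂ (i : Fin n) (_ : i ∉ S), {z | coverOutcome dflt σ ϑ cross z (i, s i) = o i} := by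
      ext z
      simp only [hgood, Set.mem_ofPred_eq, Set.mem_iUnion, Set.mem_iInter, exists_prop, and_assoc,
        eq_comm]
    rw [this]
    exact .iUnion fun o => .iUnion fun _ => .iInter fun i => .iInter fun _ =>
      measurableSet_coverOutcome_eq dflt σ ϑ cross (i, s i) (o i)
  change ∀ᵐ z ∂_, z ∈ good
  -- Fubini: it suffices to fix the simulated coins `x`, for which the coalition plays a definite
  -- deviation covered by `h`, and let only the outsiders' coins vary.
  rw [← (measurePreserving_splice S s).map_eq,
    ae_map_iff (p := (· ∈ good)) (measurePreserving_splice S s).measurable.aemeasurable hmeas,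
    Measure.ae_prod_iff_ae_ae ((measurePreserving_splice S s).measurable hmeas)]
  refine Filter.Eventually.of_forall fun x => ?_
  have hx := h (simProfile S s cross σ ϑ x a)
  have hx' : ∀ᵐ ω ∂flipsLaw n, splice S s x ω.2 ∈ good := by
    filter_upwards [hx] with ω hω
    exact ⟨_, hω, fun i hi => outcome_simProfile_of_mem dflt ω hi, fun i hi =>
      outcome_simProfile_of_notMem hs hmed hlink hθ dflt ω hi⟩
  have hsnd : Measure.map Prod.snd (flipsLaw n) = Measure.pi fun _ => coinLaw := by
    simp [flipsLaw, Measure.map_snd_prod]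
  rw [← hsnd, ae_map_iff (p := fun c => splice S s x c ∈ good) measurable_snd.aemeasurable]
  · exact hx'
  · exact ((measurePreserving_splice S s).measurable.comp measurable_prodMk_left) hmeas

/-! ### Expected and conditional utilities -/

theorem mix_empty (τ σ : Γ.Profile) : mix ∅ τ σ = σ := by
  funext i; simp [mix]

theorem expUtil_eq_zero {E : Extension n} {dflt : ∀ i, Γ.Act i} {u : Γ.Utility}
    {θ : ∀ i, Γ.Ty i} {σ : Γ.Profile} {i : Fin n}
    (h : ∀ ω, u θ (outcome E dflt σ θ ω) i = 0) : expUtil E dflt u θ σ i = 0 := by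
  refine Finset.sum_eq_zero fun a _ => ?_
  by_cases ha : u θ a i = 0
  · rw [ha, mul_zero]
  · have : {ω | outcome E dflt σ θ ω = a} = ∅ := by
      ext ω
      simp only [Set.mem_ofPred_eq, Set.mem_empty_iff_false, iff_false]
      rintro rfl
      exact ha (h ω)
    rw [outcomeProb, this]
    simp

/-- Subadditivity gives this direction without measurability of the outcome events. -/
theorem one_le_sum_outcomeProb (E : Extension n) (dflt : ∀ i, Γ.Act i) (σ : Γ.Profile)
    (θ : ∀ i, Γ.Ty i) : 1 ≤ ∑ a, outcomeProb E dflt σ θ a := by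
  have h := measureReal_iUnion_fintype_le (μ := flipsLaw n)
    (fun a : ∀ i, Γ.Act i => {ω | outcome E dflt σ θ ω = a})
  have huniv : (⋃ a : ∀ i, Γ.Act i, {ω | outcome E dflt σ θ ω = a}) = Set.univ := by
    ext ω; simp
  rw [huniv, probReal_univ] at h
  exact h

theorem condUtil_eq_zero {E : Extension n} {dflt : ∀ i, Γ.Act i} {u : Γ.Utility}
    {σ : Γ.Profile} {i : Fin n} (h : ∀ θ, expUtil E dflt u θ σ i = 0) (S : Finset (Fin n))
    (θ : ∀ i, Γ.Ty i) : condUtil E dflt u S θ σ i = 0 := by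
  simp [condUtil, h]

theorem typeProb_pos (hfull : ∀ θ, 0 < (Γ.prior θ).toReal) (S : Finset (Fin n))
    (θ : ∀ i, Γ.Ty i) : 0 < Γ.typeProb S θ := by
  refine Finset.sum_pos' (fun θ' _ => ?_) ⟨θ, Finset.mem_univ _, by simpa using hfull θ⟩
  split_ifs
  exacts [(hfull θ').le, le_rfl]

/-- Under a full-support prior, one type profile with a loss is enough, as no other profile
compensates for it. -/
theorem condUtil_neg (hfull : ∀ θ, 0 < (Γ.prior θ).toReal) {E : Extension n}
    {dflt : ∀ i, Γ.Act i} {u : Γ.Utility} {σ : Γ.Profile} {i : Fin n}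
    (hle : ∀ θ, expUtil E dflt u θ σ i ≤ 0) (S : Finset (Fin n)) (θ : ∀ i, Γ.Ty i)
    (hlt : expUtil E dflt u θ σ i < 0) : condUtil E dflt u S θ σ i < 0 := by
  refine div_neg_of_neg_of_pos ?_ (typeProb_pos hfull S θ)
  refine Finset.sum_neg' (fun θ' _ => ?_) ⟨θ, Finset.mem_univ _, ?_⟩
  · split_ifs
    exacts [mul_nonpos_of_nonneg_of_nonpos (hfull θ').le (hle θ'), le_rfl]
  · simpa using mul_neg_of_pos_of_neg (hfull θ) hlt

theorem condUtil_pos (hfull : ∀ θ, 0 < (Γ.prior θ).toReal) {E : Extension n}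
    {dflt : ∀ i, Γ.Act i} {u : Γ.Utility} {σ : Γ.Profile} {i : Fin n}
    (hle : ∀ θ, 0 ≤ expUtil E dflt u θ σ i) (S : Finset (Fin n)) (θ : ∀ i, Γ.Ty i)
    (hlt : 0 < expUtil E dflt u θ σ i) : 0 < condUtil E dflt u S θ σ i := by
  refine div_pos ?_ (typeProb_pos hfull S θ)
  refine Finset.sum_pos' (fun θ' _ => ?_) ⟨θ, Finset.mem_univ _, ?_⟩
  · split_ifs
    exacts [mul_nonneg (hfull θ').le (hle θ'), le_rfl]
  · simpa using mul_pos (hfull θ) hlt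

theorem IsStronglyRobust.isRobust {b : Baseline} {E : Extension n} {dflt : ∀ i, Γ.Act i}
    {u : Γ.Utility} {k t : ℕ} {σ : Γ.Profile} (h : IsStronglyRobust b E dflt u k t σ) :
    IsRobust b E dflt u k t σ :=
  ⟨h.1, fun K T ⟨i, hi⟩ hK hT hKT θ hθ ⟨τ, hτ⟩ => h.2 K T hK hT hKT θ hθ ⟨τ, i, hi, hτ i hi⟩⟩

/-- If no coalition of `k + t` players can influence the utilities, which are constantly zero, then
there is no profitable deviation. -/
theorem isStronglyRobust_of_expUtil_eq_zero (b : Baseline) {E : Extension n}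
    {dflt : ∀ i, Γ.Act i} {u : Γ.Utility} {k t : ℕ} {σ : Γ.Profile}
    (h₀ : ∀ θ i, expUtil E dflt u θ σ i = 0)
    (h : ∀ S : Finset (Fin n), S.card ≤ k + t → ∀ τ θ i,
      expUtil (E.addCT S) dflt u θ (mix S τ σ) i = 0) :
    IsStronglyRobust b E dflt u k t σ := by
  refine ⟨fun T hT τ i _ θ _ => ?_, ?_⟩
  · rw [condUtil_eq_zero (fun θ => h₀ θ i),
      condUtil_eq_zero (fun θ => h T (hT.trans (Nat.le_add_left _ _)) τ θ i)]
  · rintro K T hK hT hKT θ - ⟨τ, i, -, hi⟩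
    rw [Gains, condUtil_eq_zero (fun θ => h T (hT.trans (Nat.le_add_left _ _)) τ θ i),
      condUtil_eq_zero (fun θ => h (K ∪ T)
        ((Finset.card_union_le _ _).trans (add_le_add hK hT)) τ θ i)] at hi
    exact lt_irrefl _ hi

/-! ### Utilities that reward or punish an event -/

open Classical in
/-- Every player gets `c` if the event `B` occurs, and `0` otherwise. -/
def eventUtility (B : (∀ i, Γ.Ty i) → (∀ i, Γ.Act i) → Prop) (c : ℝ) : Γ.Utility :=
  fun θ a _ => if B θ a then c else 0

open Classical in
def eventProb (E : Extension n) (dflt : ∀ i, Γ.Act i)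
    (B : (∀ i, Γ.Ty i) → (∀ i, Γ.Act i) → Prop) (θ : ∀ i, Γ.Ty i) (σ : Γ.Profile) : ℝ :=
  ∑ a, if B θ a then outcomeProb E dflt σ θ a else 0

theorem expUtil_eventUtility (E : Extension n) (dflt : ∀ i, Γ.Act i)
    (B : (∀ i, Γ.Ty i) → (∀ i, Γ.Act i) → Prop) (c : ℝ) (θ : ∀ i, Γ.Ty i) (σ : Γ.Profile)
    (i : Fin n) :
    expUtil E dflt (eventUtility B c) θ σ i = c * eventProb E dflt B θ σ := by
  simp only [expUtil, eventUtility, eventProb, Finset.mul_sum]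
  refine Finset.sum_congr rfl fun a _ => ?_
  split_ifs <;> ring

theorem eventProb_nonneg (E : Extension n) (dflt : ∀ i, Γ.Act i)
    (B : (∀ i, Γ.Ty i) → (∀ i, Γ.Act i) → Prop) (θ : ∀ i, Γ.Ty i) (σ : Γ.Profile) :
    0 ≤ eventProb E dflt B θ σ := by
  refine Finset.sum_nonneg fun a _ => ?_
  split_ifs
  exacts [measureReal_nonneg, le_rfl]

theorem ae_not_of_eventProb_eq_zero {E : Extension n} {dflt : ∀ i, Γ.Act i}
    {B : (∀ i, Γ.Ty i) → (∀ i, Γ.Act i) → Prop} {θ : ∀ i, Γ.Ty i} {σ : Γ.Profile}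
    (h : eventProb E dflt B θ σ = 0) : ∀ᵐ ω ∂flipsLaw n, ¬ B θ (outcome E dflt σ θ ω) := by
  classical
  have hterm : ∀ a, B θ a → ∀ᵐ ω ∂flipsLaw n, outcome E dflt σ θ ω ≠ a := by
    intro a ha
    rw [eventProb, Finset.sum_eq_zero_iff_of_nonneg
      (fun a _ => by split_ifs; exacts [measureReal_nonneg, le_rfl])] at h
    have := h a (Finset.mem_univ a)
    rw [if_pos ha, outcomeProb, measureReal_eq_zero_iff] at this
    rw [ae_iff]
    simpa using this
  have hall : ∀ᵐ ω ∂flipsLaw n, ∀ a, B θ a → outcome E dflt σ θ ω ≠ a :=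
    ae_all_iff.2 fun a => ae_all_iff.2 fun ha => hterm a ha
  filter_upwards [hall] with ω hω hB
  exact hω _ hB rfl

/-- If a profile is robust both when the event `B` is punished and when it is rewarded, then no
coalition of `k + t` players can make `B` happen. -/
theorem eventProb_eq_zero_of_isRobust (hfull : ∀ θ, 0 < (Γ.prior θ).toReal)
    {B : (∀ i, Γ.Ty i) → (∀ i, Γ.Act i) → Prop} {b : Baseline} {E : Extension n}
    {dflt : ∀ i, Γ.Act i} {k t : ℕ} {σ : Γ.Profile} (htn : t < n)
    (hbase : ∀ θ, eventProb E dflt B θ σ = 0)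
    (himm : IsImmune E dflt (eventUtility B (-1)) t σ)
    (hrob : IsRobust b E dflt (eventUtility B 1) k t σ)
    (S : Finset (Fin n)) (hS : S.card ≤ k + t) (τ : Γ.Profile) (θ : ∀ i, Γ.Ty i) :
    eventProb (E.addCT S) dflt B θ (mix S τ σ) = 0 := by
  -- If `T` alone could cause `B`, an outsider, who exists because `t < n`, would lose in the
  -- variant paying `-1`, against immunity.
  have hT : ∀ T : Finset (Fin n), T.card ≤ t → ∀ τ θ,
      eventProb (E.addCT T) dflt B θ (mix T τ σ) = 0 := by
    intro T hT τ θ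
    obtain ⟨i, hi⟩ : ∃ i, i ∉ T := by
      by_contra! hall
      have : T = Finset.univ := Finset.eq_univ_iff_forall.2 hall
      rw [this, Finset.card_univ, Fintype.card_fin] at hT
      omega
    by_contra hne
    have hpos := (eventProb_nonneg (E.addCT T) dflt B θ (mix T τ σ)).lt_of_ne' hne
    have h := himm T hT τ i hi θ (typeProb_pos hfull _ _)
    rw [condUtil_eq_zero (fun θ => by rw [expUtil_eventUtility, hbase, mul_zero])] at h
    refine h.not_gt (condUtil_neg hfull (fun θ' => ?_) _ _ ?_)
    · rw [expUtil_eventUtility]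
      linarith [eventProb_nonneg (E.addCT T) dflt B θ' (mix T τ σ)]
    · rw [expUtil_eventUtility]
      linarith
  -- `T` is taken as large as allowed, so that at most `k` players remain for `K`.
  obtain ⟨T, hTS, hTcard⟩ := Finset.exists_subset_card_eq (min_le_right t S.card)
  have hTt : T.card ≤ t := by omega
  set K := S \ T with hK
  have hKT : K ∪ T = S := Finset.sdiff_union_of_subset hTS
  have hKcard : K.card ≤ k := by
    rw [hK, Finset.card_sdiff_of_subset hTS]; omega
  rcases K.eq_empty_or_nonempty with hemp | hne
  · rw [hemp, Finset.empty_union] at hKT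
    exact hKT ▸ hT T hTt τ θ
  · by_contra hpos
    replace hpos := (eventProb_nonneg (E.addCT S) dflt B θ (mix S τ σ)).lt_of_ne' hpos
    refine hrob.2 K T hne hKcard hTt Finset.sdiff_disjoint θ (typeProb_pos hfull _ _)
      ⟨τ, fun i _ => ?_⟩
    -- The comparison payoff is zero for every type profile, so the choice of `b` is irrelevant.
    rw [Gains, condUtil_eq_zero (fun θ => by rw [expUtil_eventUtility, hT T hTt, mul_zero]), hKT]
    refine condUtil_pos hfull (fun θ' => ?_) _ _ ?_
    · rw [expUtil_eventUtility, one_mul]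
      exact eventProb_nonneg _ _ _ _ _
    · rwa [expUtil_eventUtility, one_mul]

end GameForm

/-! ### The agreement game -/

section Agreement

open GameForm

/-- Types are bits; an action is a bit or `none`. -/
abbrev agreementForm (n : ℕ) : GameForm n where
  Ty _ := Bool
  Act _ := Option Bool
  prior := PMF.uniformOfFintype (Fin n → Bool)

theorem agreementForm_prior_pos (θ : ∀ i, (agreementForm n).Ty i) :
    0 < ((agreementForm n).prior θ).toReal := by
  refine ENNReal.toReal_pos ?_ (PMF.apply_ne_top _ _)
  rw [← PMF.mem_support_iff]
  exact PMF.mem_support_uniformOfFintype (α := Fin n → Bool) θ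

/-- All but at most `f` players choose the action `o`. -/
def AllBut (f : ℕ) (a : Fin n → Option Bool) (o : Option Bool) : Prop :=
  n ≤ (Finset.univ.filter fun i => a i = o).card + f

theorem allBut_of_forall_notMem {f : ℕ} {a : Fin n → Option Bool} {o : Option Bool}
    {S : Finset (Fin n)} (hS : S.card ≤ f) (h : ∀ i ∉ S, a i = o) : AllBut f a o := by
  have hsub : Sᶜ ⊆ Finset.univ.filter fun i => a i = o := fun i hi => by
    simpa using h i (Finset.mem_compl.1 hi)
  have := Finset.card_le_card hsub
  rw [Finset.card_compl, Fintype.card_fin] at this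
  unfold AllBut
  omega

/-- Two sets of at least `n - f` players intersect when `2 * f < n`. -/
theorem AllBut.exists_eq {f : ℕ} (hf : 2 * f < n) {a a' : Fin n → Option Bool}
    {o o' : Option Bool} (h : AllBut f a o) (h' : AllBut f a' o') : ∃ i, a i = o ∧ a' i = o' := by
  by_contra! hne
  have hd : Disjoint (Finset.univ.filter fun i => a i = o)
      (Finset.univ.filter fun i => a' i = o') :=
    Finset.disjoint_filter.2 fun i _ => hne i
  have := Finset.card_le_univ (Finset.disjUnion _ _ hd)
  rw [Finset.card_disjUnion, Fintype.card_fin] at this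
  unfold AllBut at h h'
  omega

/-- Up to `f` players, there is agreement on a bit, which is the common type if there is one. -/
def Acceptable (f : ℕ) (θ : Fin n → Bool) (a : Fin n → Option Bool) : Prop :=
  ∃ b, AllBut f a (some b) ∧ ∀ c, (∀ i, θ i = c) → b = c

/-- The mediator that sends the majority of the reported bits to everybody. -/
def majorityMediator (n : ℕ) : Mediator n where
  out _ h _ := match h with
    | [] => []
    | x :: _ => [decide (n < 2 * (Finset.univ.filter fun i => x i = [true]).card)]
  measurable_out _ _ := MeasurableSet.const _

/-- Report the type to the mediator and play the bit it sends. -/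
def obedient (n : ℕ) : (agreementForm n).Profile := fun _ =>
  { send := fun b _ _ => ⟨[b], fun _ => []⟩
    act := fun _ _ h => match h with
      | [] => none
      | v :: _ => some (some (decide (v.fromMed = [true])))
    measurable_send := fun _ _ _ => MeasurableSet.const _
    measurable_act := fun _ _ _ => MeasurableSet.const _ }

/-- Play `none`. -/
def abstain (n : ℕ) : (agreementForm n).BaseProfile := fun _ =>
  { act := fun _ _ => none
    measurable_act := fun _ _ => MeasurableSet.const _ }

/-- All outsiders get the same bit in the first stage and act on it at once, so later messages do
not matter. Outsiders are a strict majority, so their unanimous reports decide the bit. -/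
theorem exists_outcome_obedient {E : Extension n} (hE : E.med = majorityMediator n)
    (dflt : ∀ i, (agreementForm n).Act i) {S : Finset (Fin n)} (hS : 2 * S.card < n)
    (τ : (agreementForm n).Profile) (θ : Fin n → Bool) (ω : Flips n) :
    ∃ b, (∀ i ∉ S, outcome E dflt (mix S τ (obedient n)) θ ω i = some b) ∧
      ∀ c, (∀ i, θ i = c) → b = c := by
  classical
  set ρ := mix S τ (obedient n) with hρ
  set x : Fin n → Msg := fun i => ((ρ i).send (θ i) (ω.2 i) []).toMed with hx
  have hxS : ∀ i ∉ S, x i = [θ i] := fun i hi => by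
    simp only [hx, hρ, mix_of_notMem hi]; rfl
  refine ⟨decide (n < 2 * (Finset.univ.filter fun i => x i = [true]).card), fun i hi => ?_, ?_⟩
  · rw [outcome_eq_firstAction]
    refine firstAction_of_eq_some (m := 0) ?_ (by simp)
    rw [actionAt, hρ, mix_of_notMem hi, ← hρ]
    simp only [history, hE, obedient, majorityMediator]
    simp [hx]
  · intro c hc
    cases c
    · have hsub : (Finset.univ.filter fun i => x i = [true]) ⊆ S := fun i hi => by
        by_contra hiS
        simp [hxS i hiS, hc i] at hi
      have := Finset.card_le_card hsub
      simp only [decide_eq_false_iff_not]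
      omega
    · have hsub : Sᶜ ⊆ (Finset.univ.filter fun i => x i = [true]) := fun i hi => by
        simp [hxS i (Finset.mem_compl.1 hi), hc i]
      have := Finset.card_le_card hsub
      rw [Finset.card_compl, Fintype.card_fin] at this
      simp only [decide_eq_true_eq]
      omega

theorem acceptable_outcome_obedient {E : Extension n} (hE : E.med = majorityMediator n)
    (dflt : ∀ i, (agreementForm n).Act i) {f : ℕ} (hf : 2 * f < n) {S : Finset (Fin n)}
    (hS : S.card ≤ f) (τ : (agreementForm n).Profile) (θ : Fin n → Bool) (ω : Flips n) :
    Acceptable f θ (outcome E dflt (mix S τ (obedient n)) θ ω) := by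
  obtain ⟨b, hb, hc⟩ := exists_outcome_obedient hE dflt (by omega : 2 * S.card < n) τ θ ω
  exact ⟨b, allBut_of_forall_notMem hS hb, hc⟩

theorem Acceptable.not_allBut_none {f : ℕ} (hf : 2 * f < n) {θ : Fin n → Bool}
    {a : Fin n → Option Bool} (h : Acceptable f θ a) : ¬ AllBut f a none := by
  intro h'
  obtain ⟨b, hb, -⟩ := h
  obtain ⟨i, h₁, h₂⟩ := hb.exists_eq hf h'
  simp [h₁] at h₂

/-- A utility that vanishes on acceptable outcomes makes obedience robust. -/
theorem isStronglyRobust_obedient (b : Baseline) (dflt : ∀ i, (agreementForm n).Act i) {k t : ℕ}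
    (hf : 2 * (k + t) < n) {u : (agreementForm n).Utility}
    (hu : ∀ θ a i, Acceptable (k + t) θ a → u θ a i = 0) :
    IsStronglyRobust b (Extension.mediated (majorityMediator n)) dflt u k t (obedient n) := by
  refine isStronglyRobust_of_expUtil_eq_zero b (fun θ i => expUtil_eq_zero fun ω => ?_)
    fun S hS τ θ i => expUtil_eq_zero fun ω => ?_
  · have := acceptable_outcome_obedient (E := Extension.mediated (majorityMediator n)) rfl dflt hf
      (S := ∅) (Nat.zero_le _) (obedient n) θ ω
    rw [mix_empty] at this
    exact hu _ _ _ this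
  · exact hu _ _ _ (acceptable_outcome_obedient rfl dflt hf hS τ θ ω)

/-- The outsiders' abstention already triggers the loss in every execution, while obedience leads to
agreement on a bit, which excludes it. -/
theorem isPunishment_abstain (dflt : ∀ i, (agreementForm n).Act i) {f : ℕ} (hf : 2 * f < n) :
    IsPunishment (majorityMediator n) dflt
      (eventUtility (Γ := agreementForm n) (fun _ a => AllBut f a none) (-1)) f (obedient n)
      (abstain n) := by
  intro K hK φ θ _ i _
  rw [condUtil_eq_zero (E := Extension.mediated (majorityMediator n))]
  · have hout : ∀ θ ω, AllBut f (outcome (Extension.underlying.addCT K) dflt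
        (mix K φ (abstain n).lift) θ ω) none := fun θ ω => by
      refine allBut_of_forall_notMem hK fun j hj => ?_
      rw [outcome_eq_firstAction]
      refine firstAction_of_eq_some (m := 0) ?_ (by simp)
      rw [actionAt, mix_of_notMem hj]
      rfl
    have hlt : ∀ θ, expUtil (Extension.underlying.addCT K) dflt
        (eventUtility (Γ := agreementForm n) (fun _ a => AllBut f a none) (-1)) θ
        (mix K φ (abstain n).lift) i < 0 := fun θ => by
      have h : eventProb (Extension.underlying.addCT K) dflt
          (fun _ a => AllBut f a none) θ (mix K φ (abstain n).lift) =
          ∑ a, outcomeProb (Extension.underlying.addCT K) dflt (mix K φ (abstain n).lift) θ a := by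
        refine Finset.sum_congr rfl fun a _ => ?_
        split_ifs with ha
        · rfl
        · have : {ω | outcome (Extension.underlying.addCT K) dflt
              (mix K φ (abstain n).lift) θ ω = a} = ∅ := by
            ext ω
            simp only [Set.mem_ofPred_eq, Set.mem_empty_iff_false, iff_false]
            rintro rfl
            exact ha (hout θ ω)
          rw [outcomeProb, this]
          simp
      rw [expUtil_eventUtility, h]
      linarith [one_le_sum_outcomeProb (Extension.underlying.addCT K) dflt
        (mix K φ (abstain n).lift) θ]
    exact condUtil_neg agreementForm_prior_pos (fun θ => (hlt θ).le) K θ (hlt θ)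
  · refine fun θ => expUtil_eq_zero fun ω => if_neg ?_
    have := acceptable_outcome_obedient (E := Extension.mediated (majorityMediator n)) rfl dflt hf
      (S := ∅) (Nat.zero_le _) (obedient n) θ ω
    rw [mix_empty] at this
    exact this.not_allBut_none hf

/-! ### Impossibility of agreement over private channels -/

/-- With `n ≤ 3 f` players, a coalition of `f` players can prevent an acceptable outcome in any
cheap-talk protocol. -/
theorem not_forall_ae_acceptable {f : ℕ} (hf : 2 * f < n) (hn : n ≤ 3 * f)
    (dflt : ∀ i, (agreementForm n).Act i) (σ : (agreementForm n).Profile) :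
    ¬ ∀ S : Finset (Fin n), S.card ≤ f → ∀ (τ : (agreementForm n).Profile) (θ : Fin n → Bool),
      ∀ᵐ ω ∂flipsLaw n,
        Acceptable f θ (outcome (Extension.cheapTalk.addCT S) dflt (mix S τ σ) θ ω) := by
  intro h
  set A : Finset (Fin n) := Finset.univ.filter fun i => i.val < f with hA
  set B : Finset (Fin n) := Finset.univ.filter fun i => f ≤ i.val ∧ i.val < 2 * f with hB
  set C : Finset (Fin n) := Finset.univ.filter fun i => 2 * f ≤ i.val with hC
  have hcard : ∀ (S : Finset (Fin n)) (c d : ℕ), (∀ i ∈ S, c ≤ i.val ∧ i.val < d) →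
      S.card ≤ d - c := fun S c d hS => by
    have := Finset.card_le_card_of_injOn (t := Finset.Ico c d) (fun i : Fin n => i.val)
      (fun i hi => by simpa using hS i hi) Fin.val_injective.injOn
    simpa using this
  have hAf : A.card ≤ f := by
    have := hcard A 0 f (fun i hi => by simp [hA] at hi; omega)
    omega
  have hBf : B.card ≤ f := by
    have := hcard B f (2 * f) (fun i hi => by simp [hB] at hi; omega)
    omega
  have hCf : C.card ≤ f := by
    have := hcard C (2 * f) n (fun i hi => by simp [hC] at hi; omega)
    omega
  set cross : Fin n → Fin n → Bool :=
    fun i j => decide (i ∈ A ∧ j ∈ C ∨ i ∈ C ∧ j ∈ A) with hcross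
  have hABC : ∀ i, i ∈ A ∧ i ∉ B ∧ i ∉ C ∨ i ∉ A ∧ i ∈ B ∧ i ∉ C ∨ i ∉ A ∧ i ∉ B ∧ i ∈ C := by
    intro i
    simp only [hA, hB, hC, Finset.mem_filter_univ]
    omega
  -- Every copy has its level as type, so `s` is both the choice of real copies and the type
  -- profile. The coalition plays `none`, so a player found to choose a bit must lie outside it.
  have scenario : ∀ (S : Finset (Fin n)), S.card ≤ f → ∀ s : Fin n → Bool,
      (∀ i ∉ S, ∀ j ∉ S, (s i ^^ cross i j) = s j) →
      ∀ᵐ z ∂(Measure.pi fun _ : Fin n × Bool => coinLaw), ∃ o ∈ {a | Acceptable f s a},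
        (∀ i ∈ S, o i = none) ∧
        ∀ i ∉ S, o i = coverOutcome dflt σ (fun _ b => b) cross z (i, s i) := fun S hS s hs =>
    ae_coverOutcome (Γ := agreementForm n) (a := fun _ => none) (θ := s)
      (E := Extension.cheapTalk.addCT S) dflt hs rfl
      (fun _ _ => Or.inl trivial) (fun _ _ => rfl) {a | Acceptable f s a} (fun τ => h S hS τ s)
  have h₁ := scenario A hAf (fun _ => false) fun i hi j hj => by simp [hcross, hi, hj]
  -- The upper copies of A and the lower copies of C hear each other through the crossed links. This
  -- scenario shares C with the all-false one and A with the all-true one.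
  have h₂ := scenario B hBf (fun i => decide (i ∈ A)) fun i hi j hj => by
    rcases hABC i with ⟨a₁, b₁, c₁⟩ | ⟨a₁, b₁, c₁⟩ | ⟨a₁, b₁, c₁⟩ <;>
      rcases hABC j with ⟨a₂, b₂, c₂⟩ | ⟨a₂, b₂, c₂⟩ | ⟨a₂, b₂, c₂⟩ <;>
      first
      | exact absurd b₁ hi
      | exact absurd b₂ hj
      | simp only [hcross, a₁, c₁, a₂, c₂]; rfl
  have h₃ := scenario C hCf (fun _ => true) fun i hi j hj => by simp [hcross, hi, hj]
  -- All three conditions concern the same random run of the cover, so a single `z` satisfies them.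
  obtain ⟨z, ⟨o₁, ⟨b₁, ho₁, hb₁⟩, hA₁, hz₁⟩, ⟨o₂, ⟨b, ho₂, -⟩, hB₂, hz₂⟩,
    ⟨o₃, ⟨b₃, ho₃, hb₃⟩, hC₃, hz₃⟩⟩ := (h₁.and (h₂.and h₃)).exists
  rw [hb₁ false fun _ => rfl] at ho₁
  rw [hb₃ true fun _ => rfl] at ho₃
  -- If the middle scenario agrees on `false`, it clashes with the all-true one at a shared copy in
  -- A; if on `true`, with the all-false one at a shared copy in C.
  cases b
  · obtain ⟨i, hi₂, hi₃⟩ := ho₂.exists_eq hf ho₃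
    rcases hABC i with ⟨ha, hb, hc⟩ | ⟨ha, hb, hc⟩ | ⟨ha, hb, hc⟩
    · have e₂ := hz₂ i hb
      have e₃ := hz₃ i hc
      rw [decide_eq_true ha] at e₂
      rw [← e₂, hi₂] at e₃
      rw [e₃] at hi₃
      simp at hi₃
    · simp [hB₂ i hb] at hi₂
    · simp [hC₃ i hc] at hi₃
  · obtain ⟨i, hi₁, hi₂⟩ := ho₁.exists_eq hf ho₂
    rcases hABC i with ⟨ha, hb, hc⟩ | ⟨ha, hb, hc⟩ | ⟨ha, hb, hc⟩
    · simp [hA₁ i ha] at hi₁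
    · simp [hB₂ i hb] at hi₂
    · have e₁ := hz₁ i ha
      have e₂ := hz₂ i hb
      rw [decide_eq_false ha] at e₂
      rw [← e₁, hi₁] at e₂
      rw [e₂] at hi₂
      simp at hi₂

end Agreement

end CheapTalk

end

/-! ### The lower bound for robust implementation -/

theorem mainTheorem2 (n k t : ℕ) (hlow : 2 * k + 2 * t < n) (hupp : n ≤ 3 * k + 3 * t) :
    ∃ (Γ : CheapTalk.GameForm n) (u : Γ.Utility) (d : CheapTalk.Mediator n)
      (σ : Γ.Profile) (ρ : Γ.BaseProfile),
      ∀ (dflt : ∀ i, Γ.Act i) (b : CheapTalk.Baseline),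
        CheapTalk.GameForm.IsStronglyRobust b (CheapTalk.Extension.mediated d) dflt u k t σ ∧
        CheapTalk.GameForm.IsPunishment d dflt u (k + t) σ ρ ∧
        ¬ ∃ σct : Γ.Profile, ∀ u' : Γ.Utility,
          CheapTalk.GameForm.IsRobust b (CheapTalk.Extension.mediated d) dflt u' k t σ →
            CheapTalk.GameForm.IsRobustImplementation b d dflt u' k t σ σct := by
  open CheapTalk CheapTalk.GameForm in
  have hf : 2 * (k + t) < n := by omega
  refine ⟨agreementForm n, eventUtility (fun _ a => AllBut (k + t) a none) (-1),
    majorityMediator n, obedient n, abstain n, fun dflt b =>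
      ⟨isStronglyRobust_obedient b dflt hf fun θ a i ha => if_neg (ha.not_allBut_none hf),
        isPunishment_abstain dflt hf, ?_⟩⟩
  rintro ⟨σct, h⟩
  have hrob : ∀ c, IsRobust b (Extension.mediated (majorityMediator n)) dflt
      (eventUtility (fun θ a => ¬ Acceptable (k + t) θ a) c) k t (obedient n) := fun c =>
    (isStronglyRobust_obedient b dflt hf fun θ a i ha => if_neg (not_not.2 ha)).isRobust
  -- The profile `σct` does not depend on the variant, so it inherits immunity from one sign and
  -- coalition-proofness from the other.
  obtain ⟨himpl, himm, -⟩ := h _ (hrob (-1))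
  obtain ⟨-, hrob'⟩ := h _ (hrob 1)
  refine not_forall_ae_acceptable hf (by omega) dflt σct fun S hS τ θ => ?_
  have hzero := eventProb_eq_zero_of_isRobust agreementForm_prior_pos (by omega)
    (fun θ => ?_) himm hrob' S hS τ θ
  · simpa only [not_not] using ae_not_of_eventProb_eq_zero hzero
  -- With reward `1`, the expected utility of any player is the probability of the event; it
  -- vanishes with the mediator, and `himpl` transfers this to cheap talk.
  · have hmed := expUtil_eq_zero (E := Extension.mediated (majorityMediator n)) (dflt := dflt)
      (u := eventUtility (fun θ a => ¬ Acceptable (k + t) θ a) 1) (θ := θ) (σ := obedient n)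
      (i := ⟨0, by omega⟩) fun ω => if_neg (not_not.2 ?_)
    · rw [expUtil_eventUtility, one_mul] at hmed
      rw [← hmed]
      simp only [eventProb, himpl θ]
    · have := acceptable_outcome_obedient (E := Extension.mediated (majorityMediator n)) rfl dflt hf
        (S := ∅) (Nat.zero_le _) (obedient n) θ ω
      rwa [mix_empty] at this
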